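/- Let $1<B<2$ and $0<\kappa<1/2$. For $i,j\in\mathbb{N}=\{1,2,\dots\}$ let $d(i,j)$ be the smallest integer $p\ge 0$ such that $i$ and $j$ belong to the same dyadic block $\{(k-1)2^p+1,\dots,k2^p\}$ for some $k\in\mathbb{N}$. Let $\omega=(\omega_i)_{i\in\mathbb{N}}$ be a centered Gaussian process, defined on a probability space with probability $\mathbb{P}$ and expectation $\mathbb{E}$, with covariances $\mathbb{E}[\omega_i\omega_j]=\kappa^{d(i,j)}$. For $\beta\ge 0$ and $h\in\mathbb{R}$ put $Z_0^{(i)}=e^{\beta\omega_i+h}$, $$Z_{n+1}^{(i)}=\frac{Z_n^{(2i-1)}Z_n^{(2i)}+B-1}{B}\qquad(n\ge 0,\ i\ge 1),$$ and let $Z^\omega_{n,h}:=Z_n^{(1)}$ and $F_n(\beta,h):=2^{-n}\,\mathbb{E}[\log Z^\omega_{n,h}]$. For every $\beta\ge 0$ and $h\in\mathbb{R}$, the variables $2^{-n}\log Z^\omega_{n,h}$ are integrable and converge as $n\to\infty$, $\mathbb{P}$-almost surely and in $L^1(\mathbb{P})$, to a non-random finite limit $F(\beta,h)\ge 0$ (the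 quenched free energy), and $F(\beta,h)=\lim_{n\to\infty}F_n(\beta,h)$. The function $F$ is convex on $[0,\infty)\times\mathbb{R}$ (jointly in $(\beta,h)$, hence in particular in $h$), and $F(\beta,\cdot)$ is non-decreasing for every $\beta\ge0$; the functions $F_n$, $n\ge 0$, have these same two properties. Moreover $F_n$ converges to $F$ exponentially fast: for all $\beta\ge 0$, $h\in\mathbb{R}$ and $n\ge 1$, $$F_n(\beta,h)-\frac{1}{2^{n}}\log B\ \le\ F(\beta,h)\ \le\ F_n(\beta,h)+\frac{1}{2^{n}}\log\left(\frac{B^2+B-1}{B(B-1)}\right).$$ -/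

import Mathlib

open MeasureTheory ProbabilityTheory Filter Topology

/- Sites and blocks are indexed from `0`: site `i` here is the site usually numbered `i + 1`. -/

namespace HierPinning

/-- The `k`-th dyadic block of size `2 ^ p`, i.e. `{k 2^p, …, (k + 1) 2^p - 1}`. -/
def block (k p : ℕ) : Finset ℕ := Finset.Ico (k * 2 ^ p) ((k + 1) * 2 ^ p)

/-- The hierarchical distance: the least `p` such that `i` and `j` lie in a common dyadic block of
size `2 ^ p` (such a `p` always exists). -/
noncomputable def hierDist (i j : ℕ) : ℕ := sInf {p : ℕ | ∃ k : ℕ, i ∈ block k p ∧ j ∈ block k p}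

/-- `ω` is a centered Gaussian process under `P` with the hierarchical covariance
`E[ω_i ω_j] = κ ^ d(i, j)`. -/
structure IsHierarchicalGaussian {Ω : Type*} [MeasurableSpace Ω] (κ : ℝ) (ω : ℕ → Ω → ℝ)
    (P : Measure Ω) : Prop where
  gaussian : IsGaussianProcess ω P
  centered : ∀ i, ∫ x, ω i x ∂P = 0
  covariance : ∀ i j, ∫ x, ω i x * ω j x ∂P = κ ^ hierDist i j

/-- The partition function of the block number `i` of size `2 ^ n` in the environment `w`. -/
noncomputable def blockPartition (B β h : ℝ) (w : ℕ → ℝ) : ℕ → ℕ → ℝ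
  | 0, i => Real.exp (β * w i + h)
  | n + 1, i =>
    (blockPartition B β h w n (2 * i) * blockPartition B β h w n (2 * i + 1) + B - 1) / B

/-- The partition function `Z_{n,h}^ω`, that of the first block of size `2 ^ n`. -/
noncomputable def partitionFunction (B β h : ℝ) (w : ℕ → ℝ) (n : ℕ) : ℝ :=
  blockPartition B β h w n 0

/-- The random variable `2^{-n} log Z_{n,h}^ω`. -/
noncomputable def randomFreeEnergy {Ω : Type*} (B β h : ℝ) (ω : ℕ → Ω → ℝ) (n : ℕ) (x : Ω) : ℝ :=
  1 / 2 ^ n * Real.log (partitionFunction B β h (fun i => ω i x) n)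

/-- The finite-volume free energy `F_n(β, h) = 2^{-n} E[log Z_{n,h}^ω]`. -/
noncomputable def finiteFreeEnergy {Ω : Type*} [MeasurableSpace Ω] (P : Measure Ω)
    (ω : ℕ → Ω → ℝ) (B β h : ℝ) (n : ℕ) : ℝ :=
  1 / 2 ^ n * ∫ x, Real.log (partitionFunction B β h (fun i => ω i x) n) ∂P

/-- The quenched free energy `F(β, h) = lim F_n(β, h)`; a real number, hence non-random. -/
noncomputable def quenchedFreeEnergy {Ω : Type*} [MeasurableSpace Ω] (P : Measure Ω)
    (ω : ℕ → Ω → ℝ) (B β h : ℝ) : ℝ :=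
  limUnder atTop (fun n => finiteFreeEnergy P ω B β h n)

end HierPinning

namespace HierPinning

/-! On logarithms the recursion adds the values of two half-blocks and applies `logStep B`, a
convex, non-decreasing, 1-Lipschitz map. It differs from the identity by a bounded amount, provided
its argument is bounded below, which holds from scale 1 on.

Blocks of equal size have equal expected log partition functions, since the Gaussian law is
invariant under block translations. Averaging the two one-step bounds makes `F_n - 2^{-n} log B`
non-decreasing and, for `n ≥ 1`, `F_n + 2^{-n} log K` non-increasing, with `K = (B^2 + B - 1) / (B
(B - 1))`. This gives the limit and both error bounds. Convexity and monotonicity pass through the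
recursion from the affine functions `β ω_i + h`, then to the limit.

For almost sure and `L¹` convergence, cut a box of size `2^(m+r)` into `2^r` blocks of size `2^m`.
The covariance between two distinct blocks is constant, so subtracting block means decorrelates
them, and Gaussianity turns this into independence (`indepFun_logBlock_sub_blockMean`). As `κ ≤
1/2`, the means are exponentially small in `L²`, and by the Lipschitz property removing them is
cheap. With `m` and `r` close to `n/2`, the normalized free energy is exponentially close in `L²` to
a constant (`exists_forall_integral_sq_sub_le`), and summability concludes. -/

/-! ### The one-step map on the logarithmic scale -/

/-- The recursion for the partition function, read on logarithms. -/
noncomputable def logStep (B a : ℝ) : ℝ := Real.log ((Real.exp a + B - 1) / B)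

lemma logStep_arg_pos {B : ℝ} (hB : 1 < B) (a : ℝ) : 0 < (Real.exp a + B - 1) / B := by
  have := Real.exp_pos a
  apply div_pos <;> linarith

lemma logStep_mono {B : ℝ} (hB : 1 < B) : Monotone (logStep B) := by
  intro a b hab
  apply Real.log_le_log (logStep_arg_pos hB a)
  have := Real.exp_le_exp.2 hab
  gcongr

@[simp] lemma logStep_zero {B : ℝ} (hB : 1 < B) : logStep B 0 = 0 := by
  have : B ≠ 0 := by linarith
  simp [logStep, this]

lemma logStep_le_add_sub {B : ℝ} (hB : 1 < B) {a b : ℝ} (hab : a ≤ b) :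
    logStep B b ≤ logStep B a + (b - a) := by
  have h1 : 1 ≤ Real.exp (b - a) := Real.one_le_exp (by linarith)
  have h2 : Real.exp b = Real.exp a * Real.exp (b - a) := by rw [← Real.exp_add]; ring_nf
  rw [← Real.log_exp (b - a), logStep, logStep,
    ← Real.log_mul (logStep_arg_pos hB a).ne' (Real.exp_pos _).ne']
  apply Real.log_le_log (logStep_arg_pos hB b)
  rw [div_mul_eq_mul_div, h2]
  have : 0 < B := by linarith
  gcongr
  nlinarith

lemma abs_logStep_sub_le {B : ℝ} (hB : 1 < B) (a b : ℝ) :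
    |logStep B a - logStep B b| ≤ |a - b| := by
  wlog h : a ≤ b generalizing a b
  · rw [abs_sub_comm, abs_sub_comm a]
    exact this b a (le_of_not_ge h)
  rw [abs_sub_comm, abs_sub_comm a, abs_of_nonneg (sub_nonneg.2 h),
    abs_of_nonneg (sub_nonneg.2 (logStep_mono hB h))]
  linarith [logStep_le_add_sub hB h]

lemma sub_log_le_logStep {B : ℝ} (hB : 1 < B) (a : ℝ) : a - Real.log B ≤ logStep B a := by
  have hB0 : 0 < B := by linarith
  conv_lhs => rw [← Real.log_exp a]
  rw [← Real.log_div (Real.exp_pos a).ne' hB0.ne']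
  apply Real.log_le_log (by positivity)
  gcongr
  linarith

lemma log_le_logStep {B : ℝ} (hB : 1 < B) (a : ℝ) : Real.log ((B - 1) / B) ≤ logStep B a := by
  have hB0 : 0 < B := by linarith
  apply Real.log_le_log (div_pos (by linarith) hB0)
  have := Real.exp_pos a
  gcongr
  linarith

/-- The ratio `(exp a + B - 1) / (B exp a)` decreases in `a`; at `exp a = ((B - 1) / B)^2` it equals
exactly the constant on the right. -/
lemma logStep_le_add_log {B : ℝ} (hB : 1 < B) {a : ℝ} (ha : 2 * Real.log ((B - 1) / B) ≤ a) :
    logStep B a ≤ a + Real.log ((B ^ 2 + B - 1) / (B * (B - 1))) := by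
  have hB0 : 0 < B := by linarith
  have hB1 : 0 < B - 1 := by linarith
  have hK : 0 < (B ^ 2 + B - 1) / (B * (B - 1)) := by
    apply div_pos <;> nlinarith
  have h : ((B - 1) / B) ^ 2 ≤ Real.exp a := by
    rw [← Real.exp_log (show 0 < ((B - 1) / B) ^ 2 by positivity), Real.log_pow]
    exact Real.exp_le_exp.2 (by exact_mod_cast ha)
  conv_rhs => rw [← Real.log_exp a]
  rw [← Real.log_mul (Real.exp_pos a).ne' hK.ne']
  apply Real.log_le_log (logStep_arg_pos hB a)
  rw [div_pow, div_le_iff₀ (by positivity)] at h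
  rw [mul_div_assoc', div_le_div_iff₀ hB0 (by positivity)]
  have h' : 0 ≤ B * (Real.exp a * B ^ 2 - (B - 1) ^ 2) := mul_nonneg hB0.le (by linarith)
  nlinarith [h']

lemma convexOn_logStep {B : ℝ} (hB : 1 < B) : ConvexOn ℝ Set.univ (logStep B) := by
  refine ⟨convex_univ, fun a _ b _ s t hs ht hst => ?_⟩
  simp only [smul_eq_mul]
  have hc : 0 < B - 1 := by linarith
  have key : ∀ x y : ℝ, Real.exp (s * x + t * y) ≤ s * Real.exp x + t * Real.exp y :=
    fun x y => convexOn_exp.2 (Set.mem_univ x) (Set.mem_univ y) hs ht hst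
  -- Log-sum-exp argument: after normalization by `logStep B x` the two exponentials sum to the
  -- constant `B`, so convexity of `exp` applies termwise.
  have hsum : ∀ x, Real.exp (x - logStep B x) + Real.exp (Real.log (B - 1) - logStep B x) = B := by
    intro x
    have hx := logStep_arg_pos hB x
    have hx' : 0 < Real.exp x + B - 1 := by linarith [Real.exp_pos x]
    rw [Real.exp_sub, Real.exp_sub, Real.exp_log hc, logStep, Real.exp_log hx]
    field_simp
    ring
  set A := logStep B a
  set D := logStep B b
  have h1 := key (a - A) (b - D)
  have h2 := key (Real.log (B - 1) - A) (Real.log (B - 1) - D)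
  have h3 : Real.exp (s * (a - A) + t * (b - D)) * Real.exp (s * A + t * D)
      = Real.exp (s * a + t * b) := by
    rw [← Real.exp_add]; ring_nf
  have h4 : Real.exp (s * (Real.log (B - 1) - A) + t * (Real.log (B - 1) - D)) *
      Real.exp (s * A + t * D) = B - 1 := by
    rw [← Real.exp_add, show s * (Real.log (B - 1) - A) + t * (Real.log (B - 1) - D) +
      (s * A + t * D) = (s + t) * Real.log (B - 1) by ring, hst, one_mul, Real.exp_log hc]
  have h5 := Real.exp_pos (s * A + t * D)
  rw [logStep, Real.log_le_iff_le_exp (logStep_arg_pos hB _), div_le_iff₀ (by linarith)]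
  have ha := hsum a
  have hb := hsum b
  calc Real.exp (s * a + t * b) + B - 1
      = (Real.exp (s * (a - A) + t * (b - D)) +
        Real.exp (s * (Real.log (B - 1) - A) + t * (Real.log (B - 1) - D))) *
          Real.exp (s * A + t * D) := by rw [add_mul, h3, h4]; ring
    _ ≤ B * Real.exp (s * A + t * D) := by
        gcongr
        calc _ ≤ s * (Real.exp (a - A) + Real.exp (Real.log (B - 1) - A)) +
              t * (Real.exp (b - D) + Real.exp (Real.log (B - 1) - D)) := by linarith
          _ = B := by rw [ha, hb, ← add_mul, hst, one_mul]
    _ = _ := mul_comm _ _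

/-! ### The logarithm of the block partition functions -/

lemma sum_block_succ (f : ℕ → ℝ) (k n : ℕ) :
    ∑ i ∈ block k (n + 1), f i = ∑ i ∈ block (2 * k) n, f i + ∑ i ∈ block (2 * k + 1) n, f i := by
  unfold block
  have h1 : k * 2 ^ (n + 1) = 2 * k * 2 ^ n := by ring
  have h2 : (k + 1) * 2 ^ (n + 1) = (2 * k + 1 + 1) * 2 ^ n := by ring
  rw [h1, h2, Finset.sum_Ico_consecutive] <;> gcongr <;> omega

lemma card_block (k n : ℕ) : (block k n).card = 2 ^ n := by
  simp [block, add_mul]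

lemma mem_block_iff {i k n : ℕ} : i ∈ block k n ↔ i / 2 ^ n = k := by
  have : 0 < 2 ^ n := by positivity
  rw [block, Finset.mem_Ico, Nat.div_eq_iff this, add_mul, one_mul]
  omega

/-- The logarithm of the partition function of a block. -/
noncomputable def logBlock (B β h : ℝ) (w : ℕ → ℝ) (n k : ℕ) : ℝ :=
  Real.log (blockPartition B β h w n k)

lemma blockPartition_pos {B : ℝ} (hB : 1 < B) (β h : ℝ) (w : ℕ → ℝ) (n k : ℕ) :
    0 < blockPartition B β h w n k := by
  induction n generalizing k with
  | zero => exact Real.exp_pos _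
  | succ n ih =>
    have := mul_pos (ih (2 * k)) (ih (2 * k + 1))
    exact div_pos (by linarith) (by linarith)

@[simp] lemma logBlock_zero (B β h : ℝ) (w : ℕ → ℝ) (k : ℕ) :
    logBlock B β h w 0 k = β * w k + h := by
  simp [logBlock, blockPartition]

lemma logBlock_succ {B : ℝ} (hB : 1 < B) (β h : ℝ) (w : ℕ → ℝ) (n k : ℕ) :
    logBlock B β h w (n + 1) k =
      logStep B (logBlock B β h w n (2 * k) + logBlock B β h w n (2 * k + 1)) := by
  rw [logBlock, logStep, logBlock, logBlock, Real.exp_add,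
    Real.exp_log (blockPartition_pos hB ..), Real.exp_log (blockPartition_pos hB ..),
    blockPartition]

/-- The 1-Lipschitz bound passes through every scale without loss. It yields integrability
(comparison with `β = h = 0`), locality in the environment, and the cost of removing block means. -/
lemma abs_logBlock_sub_le {B : ℝ} (hB : 1 < B) (β h β' h' : ℝ) (w w' : ℕ → ℝ) (n k : ℕ) :
    |logBlock B β h w n k - logBlock B β' h' w' n k| ≤
      ∑ i ∈ block k n, |(β * w i + h) - (β' * w' i + h')| := by
  induction n generalizing k with
  | zero => simp [block]
  | succ n ih =>
    rw [logBlock_succ hB, logBlock_succ hB, sum_block_succ]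
    refine (abs_logStep_sub_le hB _ _).trans ?_
    rw [add_sub_add_comm]
    exact (abs_add_le _ _).trans (add_le_add (ih _) (ih _))

lemma logBlock_zero_zero {B : ℝ} (hB : 1 < B) (w : ℕ → ℝ) (n k : ℕ) :
    logBlock B 0 0 w n k = 0 := by
  induction n generalizing k with
  | zero => simp
  | succ n ih => rw [logBlock_succ hB, ih, ih, add_zero, logStep_zero hB]

lemma abs_logBlock_le {B : ℝ} (hB : 1 < B) (β h : ℝ) (w : ℕ → ℝ) (n k : ℕ) :
    |logBlock B β h w n k| ≤ ∑ i ∈ block k n, |β * w i + h| := by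
  simpa [logBlock_zero_zero hB] using abs_logBlock_sub_le hB β h 0 0 w w n k

lemma logBlock_congr {B : ℝ} (hB : 1 < B) (β h : ℝ) {w w' : ℕ → ℝ} {n k : ℕ}
    (hw : ∀ i ∈ block k n, w i = w' i) : logBlock B β h w n k = logBlock B β h w' n k := by
  have h0 := abs_logBlock_sub_le hB β h β h w w' n k
  rw [Finset.sum_eq_zero fun i hi => by rw [hw i hi, sub_self, abs_zero]] at h0
  exact sub_eq_zero.1 (abs_nonpos_iff.1 h0)

lemma logBlock_shift {B : ℝ} (hB : 1 < B) (β h : ℝ) (w : ℕ → ℝ) (n j k r : ℕ) :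
    logBlock B β h w n (j + k * 2 ^ r) =
      logBlock B β h (fun i => w (i + k * 2 ^ (r + n))) n j := by
  -- `r` must vary: passing to the half-blocks doubles the index, so the shift `k * 2 ^ r` becomes
  -- `k * 2 ^ (r + 1)`.
  induction n generalizing j r with
  | zero => simp
  | succ n ih =>
    have h1 := ih (2 * j) (r + 1)
    have h2 := ih (2 * j + 1) (r + 1)
    rw [logBlock_succ hB, logBlock_succ hB,
      show 2 * (j + k * 2 ^ r) = 2 * j + k * 2 ^ (r + 1) by ring,
      show 2 * j + k * 2 ^ (r + 1) + 1 = 2 * j + 1 + k * 2 ^ (r + 1) by ring, h1, h2]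
    simp only [Nat.add_right_comm r 1 n, add_assoc]

lemma logBlock_eq_logBlock_zero {B : ℝ} (hB : 1 < B) (β h : ℝ) (w : ℕ → ℝ) (n k : ℕ) :
    logBlock B β h w n k = logBlock B β h (fun i => w (i % 2 ^ n + k * 2 ^ n)) n 0 := by
  have h0 := logBlock_shift hB β h w n 0 k 0
  simp only [pow_zero, mul_one, zero_add] at h0
  rw [h0]
  refine logBlock_congr hB β h fun i hi => ?_
  rw [mem_block_iff] at hi
  rw [Nat.mod_eq_of_lt (Nat.lt_of_div_eq_zero (by positivity) hi)]

lemma measurable_logBlock {B : ℝ} (hB : 1 < B) (β h : ℝ) (n k : ℕ) :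
    Measurable fun w : ℕ → ℝ => logBlock B β h w n k := by
  induction n generalizing k with
  | zero => simp only [logBlock_zero]; fun_prop
  | succ n ih =>
    simp only [logBlock_succ hB]
    exact (logStep_mono hB).measurable.comp ((ih _).add (ih _))

lemma convexOn_logBlock {B : ℝ} (hB : 1 < B) (w : ℕ → ℝ) (n k : ℕ) :
    ConvexOn ℝ Set.univ fun q : ℝ × ℝ => logBlock B q.1 q.2 w n k := by
  induction n generalizing k with
  | zero =>
    simp only [logBlock_zero]
    refine ⟨convex_univ, fun p _ q _ s t _ _ _ => le_of_eq ?_⟩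
    simp only [Prod.fst_add, Prod.snd_add, Prod.smul_fst, Prod.smul_snd, smul_eq_mul]
    ring
  | succ n ih =>
    simp only [logBlock_succ hB]
    have hadd := (ih (2 * k)).add (ih (2 * k + 1))
    refine ⟨convex_univ, fun p hp q hq s t hs ht hst => ?_⟩
    exact (logStep_mono hB (hadd.2 hp hq hs ht hst)).trans
      ((convexOn_logStep hB).2 (Set.mem_univ _) (Set.mem_univ _) hs ht hst)

lemma monotone_logBlock {B : ℝ} (hB : 1 < B) (β : ℝ) (w : ℕ → ℝ) (n k : ℕ) :
    Monotone fun h => logBlock B β h w n k := by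
  induction n generalizing k with
  | zero => intro a b hab; simpa using hab
  | succ n ih =>
    intro a b hab
    simp only [logBlock_succ hB]
    exact logStep_mono hB (add_le_add (ih _ hab) (ih _ hab))

lemma log_le_logBlock {B : ℝ} (hB : 1 < B) (β h : ℝ) (w : ℕ → ℝ) {n : ℕ} (hn : 1 ≤ n) (k : ℕ) :
    Real.log ((B - 1) / B) ≤ logBlock B β h w n k := by
  obtain ⟨n, rfl⟩ := Nat.exists_eq_add_of_le' hn
  rw [logBlock_succ hB]
  exact log_le_logStep hB _

lemma add_sub_log_le_logBlock_succ {B : ℝ} (hB : 1 < B) (β h : ℝ) (w : ℕ → ℝ) (n k : ℕ) :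
    logBlock B β h w n (2 * k) + logBlock B β h w n (2 * k + 1) - Real.log B ≤
      logBlock B β h w (n + 1) k := by
  rw [logBlock_succ hB]
  exact sub_log_le_logStep hB _

/-- From scale 1 on the recursion itself forces `log Z ≥ log ((B - 1) / B)`; at scale 0 there is no
uniform lower bound, whence `1 ≤ n`. -/
lemma logBlock_succ_le_add_log {B : ℝ} (hB : 1 < B) (β h : ℝ) (w : ℕ → ℝ) {n : ℕ} (hn : 1 ≤ n)
    (k : ℕ) :
    logBlock B β h w (n + 1) k ≤ logBlock B β h w n (2 * k) + logBlock B β h w n (2 * k + 1) +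
      Real.log ((B ^ 2 + B - 1) / (B * (B - 1))) := by
  rw [logBlock_succ hB]
  apply logStep_le_add_log hB
  linarith [log_le_logBlock hB β h w hn (2 * k), log_le_logBlock hB β h w hn (2 * k + 1)]

/-- A block partition function factorizes over its sub-blocks of size `2 ^ m`, up to an error of
bounded size per sub-block. -/
lemma abs_logBlock_sub_sum_le {B : ℝ} (hB : 1 < B) (β h : ℝ) (w : ℕ → ℝ) {m : ℕ} (hm : 1 ≤ m)
    {D : ℝ} (hD1 : Real.log B ≤ D) (hD2 : Real.log ((B ^ 2 + B - 1) / (B * (B - 1))) ≤ D)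
    (r k : ℕ) :
    |logBlock B β h w (m + r) k - ∑ j ∈ block k r, logBlock B β h w m j| ≤ (2 ^ r - 1) * D := by
  induction r generalizing k with
  | zero => simp [block]
  | succ r ih =>
    have h1 := abs_le.1 (ih (2 * k))
    have h2 := abs_le.1 (ih (2 * k + 1))
    have h3 := add_sub_log_le_logBlock_succ hB β h w (m + r) k
    have h4 := logBlock_succ_le_add_log hB β h w (le_add_right hm : 1 ≤ m + r) k
    -- One error `D` per merging of two blocks: `2 (2^r - 1) + 1 = 2^(r+1) - 1`.
    rw [sum_block_succ, ← add_assoc, abs_le, pow_succ]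
    constructor <;> linarith

/-! ### The hierarchical distance -/

lemma hierDist_eq (i j : ℕ) : hierDist i j = sInf {p : ℕ | i / 2 ^ p = j / 2 ^ p} := by
  simp only [hierDist, mem_block_iff]
  congr 1
  ext p
  simp only [Set.mem_ofPred_eq]
  exact ⟨fun ⟨k, h1, h2⟩ => h1.trans h2.symm, fun h => ⟨_, rfl, h.symm⟩⟩

@[simp] lemma hierDist_self (i : ℕ) : hierDist i i = 0 := by
  simp [hierDist_eq]

/-- The distance between sites of two distinct blocks only depends on the blocks. -/
lemma hierDist_eq_of_mem_block {m j j' i i' l l' : ℕ} (hj : j ≠ j') (hi : i ∈ block j m)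
    (hl : l ∈ block j m) (hi' : i' ∈ block j' m) (hl' : l' ∈ block j' m) :
    hierDist i i' = hierDist l l' := by
  rw [mem_block_iff] at hi hl hi' hl'
  rw [hierDist_eq, hierDist_eq]
  congr 1
  ext p
  simp only [Set.mem_ofPred_eq]
  -- For `p ≥ m` the quotients depend only on `j` and `j'`; for `p ≤ m` equality would force `j =
  -- j'`, so both sides are false.
  rcases le_total m p with h | h
  · obtain ⟨s, rfl⟩ := Nat.exists_eq_add_of_le h
    simp only [pow_add, ← Nat.div_div_eq_div_mul, hi, hl, hi', hl']
  · obtain ⟨s, rfl⟩ := Nat.exists_eq_add_of_le h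
    simp only [pow_add, ← Nat.div_div_eq_div_mul] at hi hl hi' hl'
    constructor <;> intro h0 <;> exfalso <;> apply hj
    · rw [← hi, ← hi', h0]
    · rw [← hl, ← hl', h0]

lemma lt_hierDist_of_mem_block {m j j' i i' : ℕ} (hj : j ≠ j') (hi : i ∈ block j m)
    (hi' : i' ∈ block j' m) : m < hierDist i i' := by
  rw [mem_block_iff] at hi hi'
  rw [hierDist_eq]
  -- Nonemptiness matters, as `sInf ∅ = 0` in `ℕ`; at `p = i + i'` both quotients vanish.
  refine le_csInf ⟨i + i', ?_⟩ fun p hp => ?_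
  · have h1 : i + i' < 2 ^ (i + i') := Nat.lt_two_pow_self
    rw [Set.mem_ofPred_eq, Nat.div_eq_of_lt (by omega), Nat.div_eq_of_lt (by omega)]
  · by_contra! h
    obtain ⟨s, rfl⟩ := Nat.exists_eq_add_of_le (Nat.lt_succ_iff.1 h)
    simp only [pow_add, ← Nat.div_div_eq_div_mul] at hi hi'
    rw [Set.mem_ofPred_eq] at hp
    exact hj (by rw [← hi, ← hi', hp])

lemma hierDist_add_mul {n i j : ℕ} (hi : i < 2 ^ n) (hj : j < 2 ^ n) (k : ℕ) :
    hierDist (i + k * 2 ^ n) (j + k * 2 ^ n) = hierDist i j := by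
  rw [hierDist_eq, hierDist_eq]
  congr 1
  ext p
  simp only [Set.mem_ofPred_eq]
  have hpos : ∀ q : ℕ, 0 < 2 ^ q := fun q => by positivity
  rcases le_total n p with h | h
  · obtain ⟨s, rfl⟩ := Nat.exists_eq_add_of_le h
    simp only [pow_add, ← Nat.div_div_eq_div_mul, Nat.add_mul_div_right _ _ (hpos n),
      Nat.div_eq_of_lt hi, Nat.div_eq_of_lt hj]
  · obtain ⟨s, rfl⟩ := Nat.exists_eq_add_of_le h
    rw [show k * 2 ^ (p + s) = k * 2 ^ s * 2 ^ p by ring, Nat.add_mul_div_right _ _ (hpos p),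
      Nat.add_mul_div_right _ _ (hpos p), add_left_inj]

/-- The two half-blocks contribute `2 · 3^m`; the `2 · 4^m` cross pairs are at distance at least `m
+ 1`, hence contribute at most `2^m ≤ 3^m`. Any growth rate below `4` would serve. -/
lemma sum_sum_block_pow_hierDist_le {κ : ℝ} (hκ0 : 0 ≤ κ) (hκ1 : κ ≤ 1 / 2) (m k : ℕ) :
    ∑ i ∈ block k m, ∑ j ∈ block k m, κ ^ hierDist i j ≤ 3 ^ m := by
  induction m generalizing k with
  | zero => simp [block]
  | succ m ih =>
    have hcross : ∀ a b, a ≠ b →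
        ∑ i ∈ block a m, ∑ j ∈ block b m, κ ^ hierDist i j ≤ 2 ^ m / 2 := by
      intro a b hab
      calc ∑ i ∈ block a m, ∑ j ∈ block b m, κ ^ hierDist i j
          ≤ ∑ i ∈ block a m, ∑ j ∈ block b m, (1 / 2 : ℝ) ^ (m + 1) := by
            refine Finset.sum_le_sum fun i hi => Finset.sum_le_sum fun j hj => ?_
            exact (pow_le_pow_of_le_one hκ0 (by linarith)
              (lt_hierDist_of_mem_block hab hi hj)).trans (by gcongr)
        _ = 2 ^ m / 2 := by
            simp only [Finset.sum_const, card_block, nsmul_eq_mul]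
            push_cast
            rw [pow_succ, one_div, inv_pow]
            field_simp
    simp only [sum_block_succ, Finset.sum_add_distrib]
    have h1 := hcross (2 * k) (2 * k + 1) (by omega)
    have h2 := hcross (2 * k + 1) (2 * k) (by omega)
    have h3 := ih (2 * k)
    have h4 := ih (2 * k + 1)
    have h5 : (2 : ℝ) ^ m ≤ 3 ^ m := by gcongr; norm_num
    rw [pow_succ]
    linarith

/-! ### Gaussian vectors with the same covariances -/

/-- The characteristic function of a Gaussian vector at a linear form `L` involves only the mean and
variance of `L`, which are determined by the means and covariances of the coordinates. -/
lemma map_eq_of_hasGaussianLaw_of_covariance_eq {Ω ι : Type*} [MeasurableSpace Ω] [Fintype ι]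
    {P : Measure Ω} [IsProbabilityMeasure P] {X Y : ι → Ω → ℝ}
    (hX : HasGaussianLaw (fun x i => X i x) P) (hY : HasGaussianLaw (fun x i => Y i x) P)
    (hm : ∀ i, ∫ x, X i x ∂P = ∫ x, Y i x ∂P)
    (hc : ∀ i j, cov[X i, X j; P] = cov[Y i, Y j; P]) :
    P.map (fun x i => X i x) = P.map (fun x i => Y i x) := by
  classical
  have : IsProbabilityMeasure (P.map fun x i => X i x) :=
    Measure.isProbabilityMeasure_map hX.aemeasurable
  have : IsProbabilityMeasure (P.map fun x i => Y i x) :=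
    Measure.isProbabilityMeasure_map hY.aemeasurable
  have hX2 : ∀ i, MemLp (X i) 2 P := fun i => (hX.eval i).memLp_two
  have hY2 : ∀ i, MemLp (Y i) 2 P := fun i => (hY.eval i).memLp_two
  apply Measure.ext_of_charFunDual
  ext L
  obtain ⟨c, hL⟩ : ∃ c : ι → ℝ, ∀ v : ι → ℝ, L v = ∑ i, c i * v i := by
    refine ⟨fun i => L (Pi.single i 1), fun v => ?_⟩
    conv_lhs => rw [pi_eq_sum_univ' v, map_sum]
    refine Finset.sum_congr rfl fun i _ => ?_
    rw [map_smul, smul_eq_mul, mul_comm]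
  have hmean : ∀ Z : ι → Ω → ℝ, (∀ i, MemLp (Z i) 2 P) →
      ∫ x, L (fun i => Z i x) ∂P = ∑ i, c i * ∫ x, Z i x ∂P := by
    intro Z hZ
    simp only [hL]
    rw [integral_finsetSum _ fun i _ => ((hZ i).integrable one_le_two).const_mul _]
    simp only [integral_const_mul]
  have hvar : ∀ Z : ι → Ω → ℝ, (∀ i, MemLp (Z i) 2 P) →
      Var[fun x => L (fun i => Z i x); P] =
        ∑ i, ∑ j, c j * (c i * cov[Z i, Z j; P]) := by
    intro Z hZ
    have hmem : ∀ i, MemLp (fun x => c i * Z i x) 2 P := fun i => (hZ i).const_mul _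
    simp only [hL]
    rw [← covariance_self (memLp_finsetSum _ fun i _ => hmem i).aemeasurable,
      covariance_fun_sum_fun_sum hmem hmem]
    simp only [covariance_const_mul_left, covariance_const_mul_right]
  rw [hX.charFunDual_map_eq_fun, hY.charFunDual_map_eq_fun, hmean X hX2, hmean Y hY2,
    hvar X hX2, hvar Y hY2]
  simp only [hm, hc]

/-! ### Second moments of the block free energies -/

section Moments

variable {Ω : Type*} [MeasurableSpace Ω] {P : Measure Ω}

lemma aestronglyMeasurable_logBlock {B : ℝ} (hB : 1 < B) (β h : ℝ) {W : ℕ → Ω → ℝ}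
    (hW : ∀ i, AEMeasurable (W i) P) (n k : ℕ) :
    AEStronglyMeasurable (fun x => logBlock B β h (fun i => W i x) n k) P :=
  ((measurable_logBlock hB β h n k).comp_aemeasurable
    (aemeasurable_pi_lambda _ hW)).aestronglyMeasurable

lemma sq_logBlock_le {B : ℝ} (hB : 1 < B) (β h : ℝ) (w : ℕ → ℝ) (n k : ℕ) :
    logBlock B β h w n k ^ 2 ≤ 2 ^ n * ∑ i ∈ block k n, (β * w i + h) ^ 2 := by
  calc logBlock B β h w n k ^ 2 = |logBlock B β h w n k| ^ 2 := (sq_abs _).symm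
    _ ≤ (∑ i ∈ block k n, |β * w i + h|) ^ 2 := by
        gcongr
        exact abs_logBlock_le hB ..
    _ ≤ _ := by
        have := sq_sum_le_card_mul_sum_sq (s := block k n) (f := fun i => |β * w i + h|)
        simpa [card_block] using this

lemma memLp_logBlock [IsFiniteMeasure P] {B : ℝ} (hB : 1 < B) (β h : ℝ) {W : ℕ → Ω → ℝ}
    (hW : ∀ i, MemLp (W i) 2 P) (n k : ℕ) :
    MemLp (fun x => logBlock B β h (fun i => W i x) n k) 2 P := by
  have h1 : MemLp (fun x => ∑ i ∈ block k n, |β * W i x + h|) 2 P :=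
    memLp_finsetSum _ fun i _ => (((hW i).const_mul β).add (memLp_const h)).abs
  refine h1.mono (aestronglyMeasurable_logBlock hB β h (fun i => (hW i).aemeasurable) n k)
    (ae_of_all _ fun x => ?_)
  exact (abs_logBlock_le hB ..).trans (le_abs_self _)

lemma integral_sq_logBlock_le [IsProbabilityMeasure P] {B : ℝ} (hB : 1 < B) (β h : ℝ) {W : ℕ → Ω → ℝ}
    (hW : ∀ i, MemLp (W i) 2 P) {A : ℝ} (n k : ℕ)
    (hA : ∀ i ∈ block k n, ∫ x, W i x ^ 2 ∂P ≤ A) :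
    ∫ x, logBlock B β h (fun i => W i x) n k ^ 2 ∂P ≤
      4 ^ n * (2 * β ^ 2 * A + 2 * h ^ 2) := by
  have hint : ∀ i, Integrable (fun x => 2 * β ^ 2 * W i x ^ 2 + 2 * h ^ 2) P := fun i =>
    ((hW i).integrable_sq.const_mul _).add (integrable_const _)
  calc ∫ x, logBlock B β h (fun i => W i x) n k ^ 2 ∂P
      ≤ ∫ x, 2 ^ n * ∑ i ∈ block k n, (2 * β ^ 2 * W i x ^ 2 + 2 * h ^ 2) ∂P := by
        refine integral_mono (memLp_logBlock hB β h hW n k).integrable_sq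
          ((integrable_finsetSum _ fun i _ => hint i).const_mul _) fun x => ?_
        refine (sq_logBlock_le hB ..).trans ?_
        gcongr with i
        nlinarith [sq_nonneg (β * W i x - h)]
    _ = 2 ^ n * ∑ i ∈ block k n, (2 * β ^ 2 * ∫ x, W i x ^ 2 ∂P + 2 * h ^ 2) := by
        rw [integral_const_mul, integral_finsetSum _ fun i _ => hint i]
        congr 1
        refine Finset.sum_congr rfl fun i _ => ?_
        rw [integral_add ((hW i).integrable_sq.const_mul _) (integrable_const _),
          integral_const_mul]
        simp
    _ ≤ 2 ^ n * ∑ i ∈ block k n, (2 * β ^ 2 * A + 2 * h ^ 2) := by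
        gcongr with i hi
        exact hA i hi
    _ = _ := by
        rw [Finset.sum_const, card_block, nsmul_eq_mul, ← mul_assoc]
        push_cast
        rw [← mul_pow]
        norm_num

end Moments

/-! ### Consequences of the hierarchical covariance structure -/

/-- The average of `w` over a block. -/
noncomputable def blockMean (w : ℕ → ℝ) (m j : ℕ) : ℝ := (2 ^ m)⁻¹ * ∑ i ∈ block j m, w i

namespace IsHierarchicalGaussian

variable {Ω : Type*} [MeasurableSpace Ω] {P : Measure Ω} {κ : ℝ}
  {ω : ℕ → Ω → ℝ}

lemma memLp (hω : IsHierarchicalGaussian κ ω P) (i : ℕ) : MemLp (ω i) 2 P :=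
  (hω.gaussian.hasGaussianLaw_eval i).memLp_two

lemma cov_eq [IsProbabilityMeasure P]
    (hω : IsHierarchicalGaussian κ ω P) (i j : ℕ) :
    cov[ω i, ω j; P] = κ ^ hierDist i j := by
  rw [covariance_eq_sub (hω.memLp i) (hω.memLp j), hω.centered, ← hω.covariance]
  simp

lemma map_block_eq [IsProbabilityMeasure P]
    (hω : IsHierarchicalGaussian κ ω P) (n k : ℕ) :
    P.map (fun x (i : Fin (2 ^ n)) => ω (i + k * 2 ^ n) x) =
      P.map (fun x (i : Fin (2 ^ n)) => ω i x) := by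
  have hg : ∀ k : ℕ, HasGaussianLaw (fun x (i : Fin (2 ^ n)) => ω (i + k * 2 ^ n) x) P := by
    intro k
    have hmem : ∀ i : Fin (2 ^ n), (i : ℕ) + k * 2 ^ n ∈ block k n := by
      intro i
      rw [mem_block_iff, Nat.add_mul_div_right _ _ (by positivity), Nat.div_eq_of_lt i.2, zero_add]
    exact (hω.gaussian.hasGaussianLaw (block k n)).map
      (ContinuousLinearMap.pi fun i : Fin (2 ^ n) =>
        ContinuousLinearMap.proj (⟨_, hmem i⟩ : block k n))
  have hg0 := hg 0
  simp only [zero_mul, add_zero] at hg0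
  refine map_eq_of_hasGaussianLaw_of_covariance_eq (hg k) hg0 (fun i => ?_) fun i j => ?_
  · rw [hω.centered, hω.centered]
  · rw [hω.cov_eq, hω.cov_eq, hierDist_add_mul i.2 j.2]

/-- The free energies of the blocks of a given size all have the same expectation. -/
lemma integral_logBlock [IsProbabilityMeasure P]
    (hω : IsHierarchicalGaussian κ ω P) {B : ℝ} (hB : 1 < B) (β h : ℝ)
    (n k : ℕ) :
    ∫ x, logBlock B β h (fun i => ω i x) n k ∂P =
      ∫ x, logBlock B β h (fun i => ω i x) n 0 ∂P := by
  let g : (Fin (2 ^ n) → ℝ) → ℝ := fun v =>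
    logBlock B β h (fun i => v ⟨i % 2 ^ n, Nat.mod_lt _ (by positivity)⟩) n 0
  have hg : Measurable g :=
    (measurable_logBlock hB β h n 0).comp (measurable_pi_lambda _ fun i => measurable_pi_apply _)
  have key : ∀ k, ∫ x, logBlock B β h (fun i => ω i x) n k ∂P =
      ∫ v, g v ∂(P.map fun x (i : Fin (2 ^ n)) => ω i x) := by
    intro k
    rw [← hω.map_block_eq n k, integral_map (aemeasurable_pi_lambda _ fun i =>
      (hω.memLp _).aemeasurable) hg.aestronglyMeasurable]
    exact integral_congr_ae (ae_of_all _ fun x => logBlock_eq_logBlock_zero hB β h _ n k)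
  rw [key, key]

lemma memLp_blockMean (hω : IsHierarchicalGaussian κ ω P) (m j : ℕ) :
    MemLp (fun x => blockMean (fun i => ω i x) m j) 2 P :=
  (memLp_finsetSum _ fun i _ => hω.memLp i).const_mul _

lemma integral_sq_blockMean_le (hω : IsHierarchicalGaussian κ ω P) (hκ0 : 0 ≤ κ)
    (hκ1 : κ ≤ 1 / 2) (m j : ℕ) :
    ∫ x, blockMean (fun i => ω i x) m j ^ 2 ∂P ≤ (3 / 4) ^ m := by
  have hint : ∀ i l, Integrable (fun x => ω i x * ω l x) P := fun i l =>
    (hω.memLp i).integrable_mul (hω.memLp l)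
  have h1 : ∀ x, blockMean (fun i => ω i x) m j ^ 2 =
      ((2 ^ m)⁻¹) ^ 2 * ∑ i ∈ block j m, ∑ l ∈ block j m, ω i x * ω l x := by
    intro x
    rw [blockMean, mul_pow, sq (∑ i ∈ block j m, ω i x), Finset.sum_mul_sum]
  simp only [h1]
  rw [integral_const_mul, integral_finsetSum _ fun i _ => integrable_finsetSum _ fun l _ => hint i l]
  simp only [integral_finsetSum _ fun l _ => hint _ l, hω.covariance]
  calc _ ≤ (((2 : ℝ) ^ m)⁻¹) ^ 2 * 3 ^ m := by
        gcongr
        exact sum_sum_block_pow_hierDist_le hκ0 hκ1 m j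
    _ = (3 / 4) ^ m := by
        rw [← inv_pow, ← pow_mul, mul_comm m 2, pow_mul, ← mul_pow]
        norm_num

/-- Joint Gaussianity of the two centered blocks is what makes zero covariance imply independence.
-/
lemma isGaussianProcess_sub_blockMean (hω : IsHierarchicalGaussian κ ω P) (m j j' : ℕ) :
    IsGaussianProcess (Sum.elim
      (fun (i : block j m) x => ω i x - blockMean (fun l => ω l x) m j)
      (fun (i : block j' m) x => ω i x - blockMean (fun l => ω l x) m j')) P := by
  refine hω.gaussian.of_isGaussianProcess ?_
  have key : ∀ (j : ℕ) (i : block j m), ∃ I : Finset ℕ, ∃ L : (I → ℝ) →L[ℝ] ℝ,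
      ∀ x, ω i x - blockMean (fun l => ω l x) m j = L (I.restrict (ω · x)) := by
    intro j i
    refine ⟨block j m, ContinuousLinearMap.proj i -
      ((2 : ℝ) ^ m)⁻¹ • ∑ l : block j m, ContinuousLinearMap.proj l, fun x => ?_⟩
    simp only [blockMean, _root_.sub_apply, _root_.smul_apply,
      _root_.sum_apply, ContinuousLinearMap.proj_apply, Finset.restrict, smul_eq_mul]
    rw [Finset.sum_coe_sort (block j m) (fun l => ω l x)]
  rintro (i | i)
  · exact key j i
  · exact key j' i

/-- The four covariances in the expansion all equal `κ ^ hierDist i i'`, because the distance is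
constant across two distinct blocks; they cancel. -/
lemma cov_sub_blockMean [IsProbabilityMeasure P]
    (hω : IsHierarchicalGaussian κ ω P) {m j j' i i' : ℕ} (hj : j ≠ j')
    (hi : i ∈ block j m) (hi' : i' ∈ block j' m) :
    cov[fun x => ω i x - blockMean (fun l => ω l x) m j,
      fun x => ω i' x - blockMean (fun l => ω l x) m j'; P] = 0 := by
  have h2 : (2 : ℝ) ^ m ≠ 0 := by positivity
  have hc : ∀ l ∈ block j m, ∀ l' ∈ block j' m, cov[ω l, ω l'; P] = κ ^ hierDist i i' := by
    intro l hl l' hl'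
    rw [hω.cov_eq, hierDist_eq_of_mem_block hj hl hi hl' hi']
  have hL : ∀ l ∈ block j m,
      cov[ω l, fun x => blockMean (fun l => ω l x) m j'; P] = κ ^ hierDist i i' := by
    intro l hl
    simp only [blockMean]
    rw [covariance_const_mul_right, covariance_fun_sum_right' (fun l _ => hω.memLp l) (hω.memLp l),
      Finset.sum_congr rfl (hc l hl), Finset.sum_const, card_block, nsmul_eq_mul]
    push_cast
    rw [inv_mul_cancel_left₀ h2]
  have hR : ∀ Z : Ω → ℝ, MemLp Z 2 P → (∀ l ∈ block j m, cov[ω l, Z; P] = κ ^ hierDist i i') →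
      cov[fun x => blockMean (fun l => ω l x) m j, Z; P] = κ ^ hierDist i i' := by
    intro Z hZ h
    simp only [blockMean]
    rw [covariance_const_mul_left, covariance_fun_sum_left' (fun l _ => hω.memLp l) hZ,
      Finset.sum_congr rfl h, Finset.sum_const, card_block, nsmul_eq_mul]
    push_cast
    rw [inv_mul_cancel_left₀ h2]
  rw [covariance_fun_sub_fun_sub (hω.memLp i) (hω.memLp_blockMean m j) (hω.memLp i')
    (hω.memLp_blockMean m j'), hc i hi i' hi', hL i hi,
    hR _ (hω.memLp i') fun l hl => hc l hl i' hi', hR _ (hω.memLp_blockMean m j') hL]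
  ring

/-- Once the block averages are subtracted, the free energies of distinct blocks are
independent. -/
lemma indepFun_logBlock_sub_blockMean [IsProbabilityMeasure P]
    (hω : IsHierarchicalGaussian κ ω P) {B : ℝ} (hB : 1 < B)
    (β h : ℝ) (m : ℕ) {j j' : ℕ} (hj : j ≠ j') :
    IndepFun
      (fun x => logBlock B β h (fun i => ω i x - blockMean (fun l => ω l x) m j) m j)
      (fun x => logBlock B β h (fun i => ω i x - blockMean (fun l => ω l x) m j') m j') P := by
  classical
  have hmeas : ∀ j i, AEMeasurable (fun x => ω i x - blockMean (fun l => ω l x) m j) P :=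
    fun j i => ((hω.memLp i).sub (hω.memLp_blockMean m j)).aemeasurable
  have hind := (hω.isGaussianProcess_sub_blockMean m j j').indepFun_of_covariance_eq_zero
    (fun i => hmeas j i) (fun i => hmeas j' i)
    (fun i i' => hω.cov_sub_blockMean hj i.2 i'.2)
  -- The value `0` outside the block is irrelevant by `logBlock_congr`.
  let g : ∀ j : ℕ, (block j m → ℝ) → ℝ := fun j v =>
    logBlock B β h (fun i => if hi : i ∈ block j m then v ⟨i, hi⟩ else 0) m j
  have hg : ∀ j, Measurable (g j) := by
    intro j
    refine (measurable_logBlock hB β h m j).comp (measurable_pi_lambda _ fun i => ?_)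
    by_cases hi : i ∈ block j m
    · simp only [hi, dite_true]; fun_prop
    · simp only [hi, dite_false]; fun_prop
  have key : ∀ j, (fun x => logBlock B β h (fun i => ω i x - blockMean (fun l => ω l x) m j) m j) =
      g j ∘ fun x (i : block j m) => ω i x - blockMean (fun l => ω l x) m j := by
    intro j
    ext x
    exact logBlock_congr hB β h fun i hi => by simp [hi]
  rw [key j, key j']
  exact hind.comp (hg j) (hg j')

end IsHierarchicalGaussian

/-! ### Concentration of the free energy -/

/-- The free energy of a box of size `2 ^ (m + r)` differs from the average of the free energies of
its sub-blocks of size `2 ^ m`, computed after removal of the block averages of the environment, by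
a boundary term and by the average of the absolute values of these block averages. -/
lemma abs_logBlock_sub_sum_sub_blockMean_le {B : ℝ} (hB : 1 < B) (β h : ℝ) (w : ℕ → ℝ) {m : ℕ}
    (hm : 1 ≤ m) {D : ℝ} (hD1 : Real.log B ≤ D)
    (hD2 : Real.log ((B ^ 2 + B - 1) / (B * (B - 1))) ≤ D) (r : ℕ) :
    |logBlock B β h w (m + r) 0 -
        ∑ j ∈ block 0 r, logBlock B β h (fun i => w i - blockMean w m j) m j| ≤
      2 ^ r * D + 2 ^ m * |β| * ∑ j ∈ block 0 r, |blockMean w m j| := by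
  have hD : 0 ≤ D := (Real.log_nonneg hB.le).trans hD1
  have h1 := abs_logBlock_sub_sum_le hB β h w hm hD1 hD2 r 0
  have h2 : |∑ j ∈ block 0 r, logBlock B β h w m j -
      ∑ j ∈ block 0 r, logBlock B β h (fun i => w i - blockMean w m j) m j| ≤
      2 ^ m * |β| * ∑ j ∈ block 0 r, |blockMean w m j| := by
    rw [← Finset.sum_sub_distrib, Finset.mul_sum]
    refine (Finset.abs_sum_le_sum_abs _ _).trans (Finset.sum_le_sum fun j _ => ?_)
    refine (abs_logBlock_sub_le hB ..).trans (le_of_eq ?_)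
    simp only [show ∀ i, β * w i + h - (β * (w i - blockMean w m j) + h) = β * blockMean w m j from
      fun i => by ring, abs_mul, Finset.sum_const, card_block, nsmul_eq_mul]
    push_cast
    ring
  refine (abs_sub_le _ (∑ j ∈ block 0 r, logBlock B β h w m j) _).trans ?_
  linarith

namespace IsHierarchicalGaussian

variable {Ω : Type*} [MeasurableSpace Ω] {P : Measure Ω} {κ : ℝ}
  {ω : ℕ → Ω → ℝ}

lemma integral_sq_sub_blockMean_le (hω : IsHierarchicalGaussian κ ω P) (hκ0 : 0 ≤ κ)
    (hκ1 : κ ≤ 1 / 2) (m j i : ℕ) :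
    ∫ x, (ω i x - blockMean (fun l => ω l x) m j) ^ 2 ∂P ≤ 4 := by
  have h1 := (hω.memLp i).integrable_sq
  have h2 := (hω.memLp_blockMean m j).integrable_sq
  have h3 : ∫ x, ω i x ^ 2 ∂P = 1 := by
    simpa [sq] using hω.covariance i i
  have h4 := hω.integral_sq_blockMean_le hκ0 hκ1 m j
  have h5 : (3 / 4 : ℝ) ^ m ≤ 1 := pow_le_one₀ (by norm_num) (by norm_num)
  calc ∫ x, (ω i x - blockMean (fun l => ω l x) m j) ^ 2 ∂P
      ≤ ∫ x, (2 * ω i x ^ 2 + 2 * blockMean (fun l => ω l x) m j ^ 2) ∂P := by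
        refine integral_mono ((hω.memLp i).sub (hω.memLp_blockMean m j)).integrable_sq
          ((h1.const_mul 2).add (h2.const_mul 2)) fun x => ?_
        nlinarith [sq_nonneg (ω i x + blockMean (fun l => ω l x) m j)]
    _ ≤ 4 := by
        rw [integral_add (h1.const_mul 2) (h2.const_mul 2), integral_const_mul,
          integral_const_mul, h3]
        linarith

/-- Independence makes variances add, so the factor is `2 ^ r` rather than `4 ^ r`; inside each
block the crude second-moment bound suffices. -/
lemma variance_sum_logBlock_le [IsProbabilityMeasure P]
    (hω : IsHierarchicalGaussian κ ω P) (hκ0 : 0 ≤ κ)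
    (hκ1 : κ ≤ 1 / 2) {B : ℝ} (hB : 1 < B) (β h : ℝ) (m r : ℕ) :
    Var[fun x => ∑ j ∈ block 0 r,
      logBlock B β h (fun i => ω i x - blockMean (fun l => ω l x) m j) m j; P] ≤
      2 ^ r * (4 ^ m * (8 * β ^ 2 + 2 * h ^ 2)) := by
  have hmem : ∀ j i, MemLp (fun x => ω i x - blockMean (fun l => ω l x) m j) 2 P :=
    fun j i => (hω.memLp i).sub (hω.memLp_blockMean m j)
  have hX := fun j => memLp_logBlock hB β h (hmem j) m j
  have hsum := IndepFun.variance_sum (s := block 0 r) (fun j _ => hX j)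
    (fun j _ j' _ hj => hω.indepFun_logBlock_sub_blockMean hB β h m hj)
  rw [show (fun x => ∑ j ∈ block 0 r,
      logBlock B β h (fun i => ω i x - blockMean (fun l => ω l x) m j) m j) = ∑ j ∈ block 0 r,
      fun x => logBlock B β h (fun i => ω i x - blockMean (fun l => ω l x) m j) m j by
    ext x; simp, hsum]
  calc _ ≤ ∑ j ∈ block 0 r, (4 : ℝ) ^ m * (8 * β ^ 2 + 2 * h ^ 2) := by
        refine Finset.sum_le_sum fun j _ => ?_
        refine (variance_le_expectation_sq (hX j).aestronglyMeasurable).trans ?_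
        have := integral_sq_logBlock_le hB β h (hmem j) m j
          fun i _ => hω.integral_sq_sub_blockMean_le hκ0 hκ1 m j i
        refine this.trans (le_of_eq ?_)
        ring
    _ = _ := by
        rw [Finset.sum_const, card_block, nsmul_eq_mul]
        push_cast
        ring

/-- The three terms are the merging errors, the removed block means, and the fluctuation of the
independent sum, each squared and divided by `4^(m+r)`. -/
lemma exists_integral_sq_sub_le [IsProbabilityMeasure P]
    (hω : IsHierarchicalGaussian κ ω P) (hκ0 : 0 ≤ κ)
    (hκ1 : κ ≤ 1 / 2) {B : ℝ} (hB : 1 < B) (β h : ℝ) {m : ℕ} (hm : 1 ≤ m) {D : ℝ}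
    (hD1 : Real.log B ≤ D) (hD2 : Real.log ((B ^ 2 + B - 1) / (B * (B - 1))) ≤ D) (r : ℕ) :
    ∃ c : ℝ, ∫ x, (1 / 2 ^ (m + r) * logBlock B β h (fun i => ω i x) (m + r) 0 - c) ^ 2 ∂P ≤
      3 * (D ^ 2 * (1 / 4) ^ m + β ^ 2 * (3 / 4) ^ m + (8 * β ^ 2 + 2 * h ^ 2) * (1 / 2) ^ r) := by
  have hmem : ∀ j i, MemLp (fun x => ω i x - blockMean (fun l => ω l x) m j) 2 P :=
    fun j i => (hω.memLp i).sub (hω.memLp_blockMean m j)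
  set X : Ω → ℝ := fun x => ∑ j ∈ block 0 r,
    logBlock B β h (fun i => ω i x - blockMean (fun l => ω l x) m j) m j with hXdef
  have hX : MemLp X 2 P := memLp_finsetSum _ fun j _ => memLp_logBlock hB β h (hmem j) m j
  set S : Ω → ℝ := fun x => ∑ j ∈ block 0 r, blockMean (fun l => ω l x) m j ^ 2 with hSdef
  have hSint : Integrable S P :=
    integrable_finsetSum _ fun j _ => (hω.memLp_blockMean m j).integrable_sq
  have hS : ∫ x, S x ∂P ≤ 2 ^ r * (3 / 4) ^ m := by
    rw [integral_finsetSum _ fun j _ => (hω.memLp_blockMean m j).integrable_sq]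
    refine (Finset.sum_le_sum fun j _ => hω.integral_sq_blockMean_le hκ0 hκ1 m j).trans ?_
    rw [Finset.sum_const, card_block, nsmul_eq_mul]
    push_cast
    exact le_rfl
  have hV := hω.variance_sum_logBlock_le hκ0 hκ1 hB β h m r
  change Var[X; P] ≤ _ at hV
  rw [variance_eq_integral hX.aemeasurable] at hV
  have hVint : Integrable (fun x => (X x - ∫ y, X y ∂P) ^ 2) P :=
    (hX.sub (memLp_const _)).integrable_sq
  set e : ℝ := ∫ y, X y ∂P
  have h2r : (0 : ℝ) < 2 ^ r := by positivity
  have h2m : (0 : ℝ) < 2 ^ m := by positivity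
  have hpow : (2 : ℝ) ^ (m + r) = 2 ^ m * 2 ^ r := pow_add ..
  refine ⟨1 / 2 ^ (m + r) * e, ?_⟩
  have hpt : ∀ x, (1 / 2 ^ (m + r) * logBlock B β h (fun i => ω i x) (m + r) 0 -
      1 / 2 ^ (m + r) * e) ^ 2 ≤
      3 * (D ^ 2 / (2 ^ m) ^ 2 + β ^ 2 / 2 ^ r * S x +
        1 / (2 ^ m * 2 ^ r) ^ 2 * (X x - e) ^ 2) := by
    intro x
    have h1 := abs_logBlock_sub_sum_sub_blockMean_le hB β h (fun i => ω i x) hm hD1 hD2 r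
    change |_ - X x| ≤ _ at h1
    set M := ∑ j ∈ block 0 r, |blockMean (fun i => ω i x) m j|
    have hM : M ^ 2 ≤ 2 ^ r * S x := by
      have := sq_sum_le_card_mul_sum_sq (s := block 0 r)
        (f := fun j => |blockMean (fun i => ω i x) m j|)
      simpa [card_block] using this
    set Z := logBlock B β h (fun i => ω i x) (m + r) 0
    have h3 : (Z - e) ^ 2 ≤
        3 * ((2 ^ r * D) ^ 2 + (2 ^ m * |β| * M) ^ 2 + (X x - e) ^ 2) := by
      have h4 : |Z - e| ≤ 2 ^ r * D + 2 ^ m * |β| * M + |X x - e| :=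
        (abs_sub_le _ (X x) _).trans (by linarith)
      rw [← sq_abs (Z - e), ← sq_abs (X x - e)]
      refine (pow_le_pow_left₀ (abs_nonneg _) h4 2).trans ?_
      nlinarith [sq_nonneg (2 ^ r * D - 2 ^ m * |β| * M), sq_nonneg (2 ^ r * D - |X x - e|),
        sq_nonneg (2 ^ m * |β| * M - |X x - e|)]
    have h5 : (2 ^ m * |β| * M) ^ 2 ≤ (2 ^ m) ^ 2 * β ^ 2 * (2 ^ r * S x) := by
      rw [mul_pow, mul_pow, sq_abs]
      gcongr
    rw [← mul_sub, mul_pow, hpow]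
    calc (1 / (2 ^ m * 2 ^ r)) ^ 2 * (Z - e) ^ 2
        ≤ (1 / (2 ^ m * 2 ^ r)) ^ 2 *
          (3 * ((2 ^ r * D) ^ 2 + (2 ^ m) ^ 2 * β ^ 2 * (2 ^ r * S x) + (X x - e) ^ 2)) := by
          gcongr
          linarith
      _ = _ := by field_simp
  have hint : Integrable (fun x => D ^ 2 / (2 ^ m) ^ 2 + β ^ 2 / 2 ^ r * S x) P :=
    (integrable_const _).add (hSint.const_mul _)
  have hZ := (((memLp_logBlock hB β h hω.memLp (m + r) 0).const_mul
    (1 / 2 ^ (m + r))).sub (memLp_const (1 / 2 ^ (m + r) * e))).integrable_sq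
  refine (integral_mono hZ ((hint.add (hVint.const_mul _)).const_mul 3) hpt).trans ?_
  simp only [Pi.add_apply]
  rw [integral_const_mul, integral_add hint (hVint.const_mul _),
    integral_add (integrable_const _) (hSint.const_mul _), integral_const_mul, integral_const_mul]
  have e1 : D ^ 2 / (2 ^ m) ^ 2 = D ^ 2 * (1 / 4 : ℝ) ^ m := by
    rw [← pow_mul, mul_comm m, pow_mul, one_div, inv_pow]; norm_num; rfl
  have e2 : β ^ 2 / 2 ^ r * ∫ x, S x ∂P ≤ β ^ 2 * (3 / 4) ^ m :=
    (mul_le_mul_of_nonneg_left hS (by positivity)).trans (le_of_eq (by field_simp))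
  have e3 : 1 / (2 ^ m * 2 ^ r) ^ 2 * ∫ x, (X x - e) ^ 2 ∂P ≤
      (8 * β ^ 2 + 2 * h ^ 2) * (1 / 2) ^ r := by
    refine (mul_le_mul_of_nonneg_left hV (by positivity)).trans (le_of_eq ?_)
    rw [show (4 : ℝ) ^ m = (2 ^ m) ^ 2 by rw [← pow_mul, mul_comm m, pow_mul]; norm_num, one_div_pow]
    field_simp
  simp only [integral_const, probReal_univ, one_smul]
  rw [e1]
  linarith

/-- The random free energy concentrates exponentially fast in the square mean. -/
lemma exists_forall_integral_sq_sub_le [IsProbabilityMeasure P]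
    (hω : IsHierarchicalGaussian κ ω P) (hκ0 : 0 ≤ κ)
    (hκ1 : κ ≤ 1 / 2) {B : ℝ} (hB : 1 < B) (β h : ℝ) :
    ∃ (C : ℝ) (c : ℕ → ℝ), ∀ n, 1 ≤ n →
      ∫ x, (1 / 2 ^ n * logBlock B β h (fun i => ω i x) n 0 - c n) ^ 2 ∂P ≤ C * (9 / 10) ^ n := by
  set D := max (Real.log B) (Real.log ((B ^ 2 + B - 1) / (B * (B - 1))))
  set A := D ^ 2 + β ^ 2 + (8 * β ^ 2 + 2 * h ^ 2) with hA
  have hA0 : 0 ≤ A := by positivity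
  have key : ∀ n, ∃ c : ℝ, 1 ≤ n →
      ∫ x, (1 / 2 ^ n * logBlock B β h (fun i => ω i x) n 0 - c) ^ 2 ∂P ≤
        3 * A * (10 / 9) * (9 / 10) ^ n := by
    intro n
    rcases Nat.eq_zero_or_pos n with rfl | hn
    · exact ⟨0, fun h => absurd h (by norm_num)⟩
    -- Rounding up in `m = n - n / 2` keeps `m ≥ 1` for every `n ≥ 1`.
    obtain ⟨c, hc⟩ := hω.exists_integral_sq_sub_le hκ0 hκ1 hB β h (m := n - n / 2) (by omega)
      (le_max_left _ _) (le_max_right _ _) (n / 2)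
    rw [Nat.sub_add_cancel (Nat.div_le_self n 2)] at hc
    refine ⟨c, fun _ => hc.trans ?_⟩
    set q := n / 2
    have hq : q ≤ n - q := by omega
    -- `3/4 ≤ (9/10)^2`, and `10/9` absorbs the parity loss `n ≤ 2q + 1`.
    have h1 : (3 / 4 : ℝ) ^ q ≤ 10 / 9 * (9 / 10) ^ n := by
      calc (3 / 4 : ℝ) ^ q ≤ ((9 / 10) ^ 2) ^ q := by gcongr; norm_num
        _ = 10 / 9 * (9 / 10) ^ (2 * q + 1) := by rw [← pow_mul, pow_succ]; ring
        _ ≤ 10 / 9 * (9 / 10) ^ n := by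
          gcongr ?_ * ?_
          exact pow_le_pow_of_le_one (by norm_num) (by norm_num) (by omega)
    have h2 : (3 / 4 : ℝ) ^ (n - q) ≤ (3 / 4) ^ q :=
      pow_le_pow_of_le_one (by norm_num) (by norm_num) hq
    have h3 : (1 / 4 : ℝ) ^ (n - q) ≤ (3 / 4) ^ (n - q) := by gcongr; norm_num
    have h4 : (1 / 2 : ℝ) ^ q ≤ (3 / 4) ^ q := pow_le_pow_left₀ (by norm_num) (by norm_num) q
    calc _ ≤ 3 * (D ^ 2 * (3 / 4) ^ q + β ^ 2 * (3 / 4) ^ q +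
          (8 * β ^ 2 + 2 * h ^ 2) * (3 / 4) ^ q) := by
          gcongr
          exact h3.trans h2
      _ = 3 * A * (3 / 4) ^ q := by rw [hA]; ring
      _ ≤ 3 * A * (10 / 9 * (9 / 10) ^ n) := by gcongr
      _ = _ := by ring
  choose c hc using key
  exact ⟨_, c, hc⟩

end IsHierarchicalGaussian

lemma sq_integral_abs_le {Ω : Type*} [MeasurableSpace Ω] {P : Measure Ω} [IsProbabilityMeasure P]
    {X : Ω → ℝ} (hX : MemLp X 2 P) : (∫ x, |X x| ∂P) ^ 2 ≤ ∫ x, X x ^ 2 ∂P := by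
  have h0 := variance_nonneg |X| P
  rw [variance_eq_sub hX.abs] at h0
  simp only [Pi.pow_apply, Pi.abs_apply, sq_abs] at h0
  linarith

lemma finiteFreeEnergy_eq_integral {Ω : Type*} [MeasurableSpace Ω] (P : Measure Ω) (B β h : ℝ)
    (ω : ℕ → Ω → ℝ) (n : ℕ) :
    finiteFreeEnergy P ω B β h n = ∫ x, randomFreeEnergy B β h ω n x ∂P :=
  (integral_const_mul _ _).symm

namespace IsHierarchicalGaussian

variable {Ω : Type*} [MeasurableSpace Ω] {P : Measure Ω} [IsProbabilityMeasure P] {κ : ℝ}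
  {ω : ℕ → Ω → ℝ} {B : ℝ}

/-! ### Exponential convergence of the finite-volume free energies -/

lemma memLp_randomFreeEnergy (hω : IsHierarchicalGaussian κ ω P) (hB : 1 < B) (β h : ℝ) (n : ℕ) :
    MemLp (randomFreeEnergy B β h ω n) 2 P :=
  (memLp_logBlock hB β h hω.memLp n 0).const_mul _

lemma integrable_logBlock (hω : IsHierarchicalGaussian κ ω P) (hB : 1 < B) (β h : ℝ) (n k : ℕ) :
    Integrable (fun x => logBlock B β h (fun i => ω i x) n k) P :=
  (memLp_logBlock hB β h hω.memLp n k).integrable one_le_two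

/-- Each step loses at most `2^{-(n+1)} log B`, which is exactly `2^{-n} log B - 2^{-(n+1)} log B`.
-/
lemma monotone_finiteFreeEnergy_sub (hω : IsHierarchicalGaussian κ ω P) (hB : 1 < B) (β h : ℝ) :
    Monotone fun n => finiteFreeEnergy P ω B β h n - 1 / 2 ^ n * Real.log B := by
  refine monotone_nat_of_le_succ fun n => ?_
  have h1 := integral_mono
    (((hω.integrable_logBlock hB β h n (2 * 0)).add
      (hω.integrable_logBlock hB β h n (2 * 0 + 1))).sub (integrable_const (Real.log B)))
    (hω.integrable_logBlock hB β h (n + 1) 0)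
    fun x => add_sub_log_le_logBlock_succ hB β h (fun i => ω i x) n 0
  rw [integral_sub' ((hω.integrable_logBlock hB β h n (2 * 0)).add
      (hω.integrable_logBlock hB β h n (2 * 0 + 1))) (integrable_const _),
    integral_add' (hω.integrable_logBlock hB β h n (2 * 0))
      (hω.integrable_logBlock hB β h n (2 * 0 + 1)),
    hω.integral_logBlock hB β h n (2 * 0), hω.integral_logBlock hB β h n (2 * 0 + 1)] at h1
  simp only [integral_const, probReal_univ, one_smul] at h1
  change 1 / 2 ^ n * ∫ x, logBlock B β h (fun i => ω i x) n 0 ∂P - 1 / 2 ^ n * Real.log B ≤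
    1 / 2 ^ (n + 1) * ∫ x, logBlock B β h (fun i => ω i x) (n + 1) 0 ∂P -
      1 / 2 ^ (n + 1) * Real.log B
  set E := ∫ x, logBlock B β h (fun i => ω i x) n 0 ∂P
  calc 1 / 2 ^ n * E - 1 / 2 ^ n * Real.log B
      = 1 / 2 ^ (n + 1) * (E + E - Real.log B - Real.log B) := by rw [pow_succ]; field_simp; ring
    _ ≤ 1 / 2 ^ (n + 1) *
        (∫ x, logBlock B β h (fun i => ω i x) (n + 1) 0 ∂P - Real.log B) := by gcongr
    _ = _ := mul_sub _ _ _

lemma antitone_finiteFreeEnergy_add (hω : IsHierarchicalGaussian κ ω P) (hB : 1 < B) (β h : ℝ) :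
    Antitone fun n => finiteFreeEnergy P ω B β h (n + 1) +
      1 / 2 ^ (n + 1) * Real.log ((B ^ 2 + B - 1) / (B * (B - 1))) := by
  refine antitone_nat_of_succ_le fun n => ?_
  set K := Real.log ((B ^ 2 + B - 1) / (B * (B - 1)))
  have h1 := integral_mono (hω.integrable_logBlock hB β h (n + 1 + 1) 0)
    (((hω.integrable_logBlock hB β h (n + 1) (2 * 0)).add
      (hω.integrable_logBlock hB β h (n + 1) (2 * 0 + 1))).add (integrable_const K))
    fun x => logBlock_succ_le_add_log hB β h (fun i => ω i x) (Nat.le_add_left 1 n) 0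
  rw [integral_add' ((hω.integrable_logBlock hB β h (n + 1) (2 * 0)).add
      (hω.integrable_logBlock hB β h (n + 1) (2 * 0 + 1))) (integrable_const _),
    integral_add' (hω.integrable_logBlock hB β h (n + 1) (2 * 0))
      (hω.integrable_logBlock hB β h (n + 1) (2 * 0 + 1)),
    hω.integral_logBlock hB β h (n + 1) (2 * 0),
    hω.integral_logBlock hB β h (n + 1) (2 * 0 + 1)] at h1
  simp only [integral_const, probReal_univ, one_smul] at h1
  change 1 / 2 ^ (n + 1 + 1) * ∫ x, logBlock B β h (fun i => ω i x) (n + 1 + 1) 0 ∂P +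
      1 / 2 ^ (n + 1 + 1) * K ≤
    1 / 2 ^ (n + 1) * ∫ x, logBlock B β h (fun i => ω i x) (n + 1) 0 ∂P + 1 / 2 ^ (n + 1) * K
  set E := ∫ x, logBlock B β h (fun i => ω i x) (n + 1) 0 ∂P
  calc _ = 1 / 2 ^ (n + 1 + 1) *
        (∫ x, logBlock B β h (fun i => ω i x) (n + 1 + 1) 0 ∂P + K) := (mul_add _ _ _).symm
    _ ≤ 1 / 2 ^ (n + 1 + 1) * (E + E + K + K) := by gcongr
    _ = _ := by rw [pow_succ _ (n + 1)]; field_simp; ring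

lemma tendsto_one_div_two_pow_mul (a : ℝ) :
    Tendsto (fun n : ℕ => 1 / (2 : ℝ) ^ n * a) atTop (𝓝 0) := by
  simp only [← one_div_pow]
  simpa using (tendsto_pow_atTop_nhds_zero_of_lt_one (r := (1 / 2 : ℝ)) (by norm_num)
    (by norm_num)).mul_const a

lemma tendsto_finiteFreeEnergy (hω : IsHierarchicalGaussian κ ω P) (hB : 1 < B) (β h : ℝ) :
    Tendsto (fun n => finiteFreeEnergy P ω B β h n) atTop (𝓝 (quenchedFreeEnergy P ω B β h)) := by
  have hmono := hω.monotone_finiteFreeEnergy_sub hB β h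
  have hanti := hω.antitone_finiteFreeEnergy_add hB β h
  set K := Real.log ((B ^ 2 + B - 1) / (B * (B - 1)))
  have hlogB : 0 ≤ Real.log B := Real.log_nonneg hB.le
  have hK : 0 ≤ K := by
    apply Real.log_nonneg
    have : 0 < B * (B - 1) := by nlinarith
    rw [le_div_iff₀ this]
    linarith
  have hbdd : BddAbove (Set.range fun n =>
      finiteFreeEnergy P ω B β h n - 1 / 2 ^ n * Real.log B) := by
    refine ⟨finiteFreeEnergy P ω B β h (0 + 1) + 1 / 2 ^ (0 + 1) * K, ?_⟩
    rintro _ ⟨n, rfl⟩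
    have h1 := hmono (Nat.le_succ n)
    have h2 := hanti (Nat.zero_le n)
    have h3 : 0 ≤ 1 / 2 ^ (n + 1) * K := by positivity
    have h4 : 0 ≤ 1 / 2 ^ (n + 1) * Real.log B := by positivity
    simp only [Nat.succ_eq_add_one] at h1 h2 ⊢
    linarith
  have hlim := (tendsto_atTop_ciSup hmono hbdd).add (tendsto_one_div_two_pow_mul (Real.log B))
  simp only [sub_add_cancel] at hlim
  rw [quenchedFreeEnergy, hlim.limUnder_eq]
  exact hlim

lemma finiteFreeEnergy_sub_le (hω : IsHierarchicalGaussian κ ω P) (hB : 1 < B) (β h : ℝ) (n : ℕ) :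
    finiteFreeEnergy P ω B β h n - 1 / 2 ^ n * Real.log B ≤ quenchedFreeEnergy P ω B β h := by
  have hlim := (hω.tendsto_finiteFreeEnergy hB β h).sub (tendsto_one_div_two_pow_mul (Real.log B))
  rw [sub_zero] at hlim
  exact (hω.monotone_finiteFreeEnergy_sub hB β h).ge_of_tendsto hlim n

lemma quenchedFreeEnergy_le (hω : IsHierarchicalGaussian κ ω P) (hB : 1 < B) (β h : ℝ) {n : ℕ}
    (hn : 1 ≤ n) :
    quenchedFreeEnergy P ω B β h ≤ finiteFreeEnergy P ω B β h n +
      1 / 2 ^ n * Real.log ((B ^ 2 + B - 1) / (B * (B - 1))) := by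
  obtain ⟨n, rfl⟩ := Nat.exists_eq_add_of_le' hn
  have hlim := (hω.tendsto_finiteFreeEnergy hB β h).add
    (tendsto_one_div_two_pow_mul (Real.log ((B ^ 2 + B - 1) / (B * (B - 1)))))
  rw [add_zero] at hlim
  exact (hω.antitone_finiteFreeEnergy_add hB β h).le_of_tendsto
    (hlim.comp (tendsto_add_atTop_nat 1)) n

/-- The deterministic lower bound on `log Z` from scale 1 on disappears after division by `2^n`. -/
lemma quenchedFreeEnergy_nonneg (hω : IsHierarchicalGaussian κ ω P) (hB : 1 < B) (β h : ℝ) :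
    0 ≤ quenchedFreeEnergy P ω B β h := by
  refine le_of_tendsto_of_tendsto (tendsto_one_div_two_pow_mul (Real.log ((B - 1) / B)))
    (hω.tendsto_finiteFreeEnergy hB β h) ?_
  filter_upwards [eventually_ge_atTop 1] with n hn
  have h1 := integral_mono (integrable_const (Real.log ((B - 1) / B)))
    (hω.integrable_logBlock hB β h n 0) fun x => log_le_logBlock hB β h (fun i => ω i x) hn 0
  simp only [integral_const, probReal_univ, one_smul] at h1
  exact mul_le_mul_of_nonneg_left h1 (by positivity)

/-! ### Convexity and monotonicity -/

lemma convexOn_finiteFreeEnergy (hω : IsHierarchicalGaussian κ ω P) (hB : 1 < B) (n : ℕ) :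
    ConvexOn ℝ Set.univ fun q : ℝ × ℝ => finiteFreeEnergy P ω B q.1 q.2 n := by
  refine ⟨convex_univ, fun p hp q hq s t hs ht hst => ?_⟩
  have h1 := integral_mono (hω.integrable_logBlock hB (s • p + t • q).1 (s • p + t • q).2 n 0)
    (((hω.integrable_logBlock hB p.1 p.2 n 0).const_mul s).add
      ((hω.integrable_logBlock hB q.1 q.2 n 0).const_mul t))
    fun x => (convexOn_logBlock hB (fun i => ω i x) n 0).2 hp hq hs ht hst
  rw [integral_add' ((hω.integrable_logBlock hB p.1 p.2 n 0).const_mul s)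
    ((hω.integrable_logBlock hB q.1 q.2 n 0).const_mul t), integral_const_mul,
    integral_const_mul] at h1
  refine (mul_le_mul_of_nonneg_left h1 (by positivity : (0 : ℝ) ≤ 1 / 2 ^ n)).trans (le_of_eq ?_)
  simp only [smul_eq_mul, finiteFreeEnergy, partitionFunction, logBlock]
  ring

lemma monotone_finiteFreeEnergy (hω : IsHierarchicalGaussian κ ω P) (hB : 1 < B) (β : ℝ) (n : ℕ) :
    Monotone fun h => finiteFreeEnergy P ω B β h n := fun a b hab =>
  mul_le_mul_of_nonneg_left (integral_mono (hω.integrable_logBlock hB β a n 0)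
    (hω.integrable_logBlock hB β b n 0) fun x => monotone_logBlock hB β (fun i => ω i x) n 0 hab)
    (by positivity)

lemma convexOn_quenchedFreeEnergy (hω : IsHierarchicalGaussian κ ω P) (hB : 1 < B) :
    ConvexOn ℝ Set.univ fun q : ℝ × ℝ => quenchedFreeEnergy P ω B q.1 q.2 :=
  ⟨convex_univ, fun _ hp _ hq _ _ hs ht hst =>
    le_of_tendsto_of_tendsto' (hω.tendsto_finiteFreeEnergy hB _ _)
      (((hω.tendsto_finiteFreeEnergy hB _ _).const_mul _).add
        ((hω.tendsto_finiteFreeEnergy hB _ _).const_mul _))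
      fun n => (hω.convexOn_finiteFreeEnergy hB n).2 hp hq hs ht hst⟩

lemma monotone_quenchedFreeEnergy (hω : IsHierarchicalGaussian κ ω P) (hB : 1 < B) (β : ℝ) :
    Monotone fun h => quenchedFreeEnergy P ω B β h := fun a b hab =>
  le_of_tendsto_of_tendsto' (hω.tendsto_finiteFreeEnergy hB β a)
    (hω.tendsto_finiteFreeEnergy hB β b) fun n => hω.monotone_finiteFreeEnergy hB β n hab

/-! ### Almost sure and mean convergence -/

lemma exists_summable_integral_abs_sub_le (hω : IsHierarchicalGaussian κ ω P) (hκ0 : 0 ≤ κ)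
    (hκ1 : κ ≤ 1 / 2) (hB : 1 < B) (β h : ℝ) :
    ∃ c : ℕ → ℝ, Summable fun n =>
      ∫ x, |randomFreeEnergy B β h ω (n + 1) x - c (n + 1)| ∂P := by
  obtain ⟨C, c, hC⟩ := hω.exists_forall_integral_sq_sub_le hκ0 hκ1 hB β h
  refine ⟨c, ?_⟩
  have hρ : √(9 / 10 : ℝ) < 1 := by
    rw [Real.sqrt_lt' one_pos]; norm_num
  refine Summable.of_nonneg_of_le (fun n => integral_nonneg fun x => abs_nonneg _) (fun n => ?_)
    (((summable_nat_add_iff 1).2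
      (summable_geometric_of_lt_one (Real.sqrt_nonneg _) hρ)).mul_left (√C))
  have h1 := (sq_integral_abs_le ((hω.memLp_randomFreeEnergy hB β h (n + 1)).sub
    (memLp_const (c (n + 1))))).trans (hC (n + 1) (Nat.le_add_left 1 n))
  have h2 := (le_abs_self _).trans (Real.abs_le_sqrt h1)
  rw [Real.sqrt_mul' _ (by positivity)] at h2
  refine h2.trans (le_of_eq ?_)
  congr 1
  rw [Real.sqrt_eq_iff_mul_self_eq (by positivity) (by positivity), ← mul_pow,
    Real.mul_self_sqrt (by norm_num)]

lemma tendsto_randomFreeEnergy (hω : IsHierarchicalGaussian κ ω P) (hκ0 : 0 ≤ κ)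
    (hκ1 : κ ≤ 1 / 2) (hB : 1 < B) (β h : ℝ) :
    (∀ᵐ x ∂P, Tendsto (fun n => randomFreeEnergy B β h ω n x) atTop
      (𝓝 (quenchedFreeEnergy P ω B β h))) ∧
    Tendsto (fun n => eLpNorm (fun x => randomFreeEnergy B β h ω n x -
      quenchedFreeEnergy P ω B β h) 1 P) atTop (𝓝 0) := by
  obtain ⟨c, hc⟩ := hω.exists_summable_integral_abs_sub_le hκ0 hκ1 hB β h
  set F := quenchedFreeEnergy P ω B β h
  have hY : ∀ n, Integrable (randomFreeEnergy B β h ω n) P := fun n =>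
    (hω.memLp_randomFreeEnergy hB β h n).integrable one_le_two
  have hYa : ∀ n a, Integrable (fun x => randomFreeEnergy B β h ω n x - a) P := fun n a =>
    (hY n).sub (integrable_const a)
  have hnorm : ∀ n a, eLpNorm (fun x => randomFreeEnergy B β h ω n x - a) 1 P =
      ENNReal.ofReal (∫ x, |randomFreeEnergy B β h ω n x - a| ∂P) := by
    intro n a
    rw [eLpNorm_one_eq_lintegral_enorm, ← ofReal_integral_norm_eq_lintegral_enorm (hYa n a)]
    rfl
  have hF := (tendsto_add_atTop_iff_nat 1).2 (hω.tendsto_finiteFreeEnergy hB β h)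
  -- The centering constants come from concentration and are not the means `F_n`; `L¹` closeness
  -- forces the two to have the same limit.
  have hdiff : Tendsto (fun n => finiteFreeEnergy P ω B β h (n + 1) - c (n + 1)) atTop (𝓝 0) := by
    refine squeeze_zero_norm (fun n => ?_) hc.tendsto_atTop_zero
    have h1 : finiteFreeEnergy P ω B β h (n + 1) - c (n + 1) =
        ∫ x, (randomFreeEnergy B β h ω (n + 1) x - c (n + 1)) ∂P := by
      rw [integral_sub (hY _) (integrable_const _), finiteFreeEnergy_eq_integral]
      simp
    rw [h1]
    exact norm_integral_le_integral_norm _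
  have hcF : Tendsto (fun n => c (n + 1)) atTop (𝓝 F) := by
    simpa using hF.sub hdiff
  constructor
  -- Summable `L¹` norms make the series of deviations almost surely absolutely summable, so its
  -- terms tend to zero.
  · have hsum := summable_norm_of_tsum_eLpNorm_ne_top le_rfl
      (f := fun n x => randomFreeEnergy B β h ω (n + 1) x - c (n + 1)) (μ := P)
      (fun n => (hYa _ _).aestronglyMeasurable) (by
        simp only [hnorm]
        exact hc.tsum_ofReal_ne_top)
    filter_upwards [hsum] with x hx
    rw [← tendsto_add_atTop_iff_nat 1]
    simpa using (tendsto_zero_iff_norm_tendsto_zero.2 hx.tendsto_atTop_zero).add hcF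
  · rw [← tendsto_add_atTop_iff_nat 1]
    simp only [hnorm]
    rw [← ENNReal.ofReal_zero]
    refine ENNReal.tendsto_ofReal ?_
    have hlim : Tendsto (fun n => ∫ x, |randomFreeEnergy B β h ω (n + 1) x - c (n + 1)| ∂P +
        |c (n + 1) - F|) atTop (𝓝 0) := by
      simpa using hc.tendsto_atTop_zero.add (hcF.sub_const F).abs
    refine squeeze_zero (fun n => integral_nonneg fun x => abs_nonneg _) (fun n => ?_) hlim
    have h1 := integral_mono (hYa (n + 1) F).abs
      ((hYa (n + 1) (c (n + 1))).abs.add (integrable_const |c (n + 1) - F|))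
      fun x => abs_sub_le (randomFreeEnergy B β h ω (n + 1) x) (c (n + 1)) F
    rw [integral_add' (hYa (n + 1) (c (n + 1))).abs (integrable_const _)] at h1
    simpa using h1

end IsHierarchicalGaussian

end HierPinning

theorem theorem2p1 {Ω : Type*} [MeasurableSpace Ω] (P : Measure Ω) [IsProbabilityMeasure P]
    (B κ : ℝ) (hB1 : 1 < B) (hB2 : B < 2) (hκ0 : 0 < κ) (hκ1 : κ < 1 / 2)
    (ω : ℕ → Ω → ℝ) (hω : HierPinning.IsHierarchicalGaussian κ ω P) :
    -- the limit exists almost surely and in `L¹`, is constant, and is the limit of `F_n`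
    (∀ β : ℝ, 0 ≤ β → ∀ h : ℝ,
      (∀ᵐ x ∂P, Tendsto (fun n => HierPinning.randomFreeEnergy B β h ω n x) atTop
        (𝓝 (HierPinning.quenchedFreeEnergy P ω B β h))) ∧
      (∀ n, Integrable (HierPinning.randomFreeEnergy B β h ω n) P) ∧
      Tendsto (fun n => eLpNorm (fun x => HierPinning.randomFreeEnergy B β h ω n x -
        HierPinning.quenchedFreeEnergy P ω B β h) 1 P) atTop (𝓝 0) ∧
      Tendsto (fun n => HierPinning.finiteFreeEnergy P ω B β h n) atTop
        (𝓝 (HierPinning.quenchedFreeEnergy P ω B β h)) ∧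
      0 ≤ HierPinning.quenchedFreeEnergy P ω B β h) ∧
    -- `F` is (jointly) convex, and non-decreasing in `h`
    ConvexOn ℝ {q : ℝ × ℝ | 0 ≤ q.1}
      (fun q => HierPinning.quenchedFreeEnergy P ω B q.1 q.2) ∧
    (∀ β : ℝ, 0 ≤ β → Monotone (fun h => HierPinning.quenchedFreeEnergy P ω B β h)) ∧
    -- so is each `F_n`
    (∀ n : ℕ, ConvexOn ℝ {q : ℝ × ℝ | 0 ≤ q.1}
      (fun q => HierPinning.finiteFreeEnergy P ω B q.1 q.2 n)) ∧
    (∀ n : ℕ, ∀ β : ℝ, 0 ≤ β → Monotone (fun h => HierPinning.finiteFreeEnergy P ω B β h n)) ∧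
    -- speed of convergence
    (∀ β : ℝ, 0 ≤ β → ∀ h : ℝ, ∀ n : ℕ, 1 ≤ n →
      HierPinning.finiteFreeEnergy P ω B β h n - 1 / 2 ^ n * Real.log B
          ≤ HierPinning.quenchedFreeEnergy P ω B β h ∧
        HierPinning.quenchedFreeEnergy P ω B β h
          ≤ HierPinning.finiteFreeEnergy P ω B β h n +
            1 / 2 ^ n * Real.log ((B ^ 2 + B - 1) / (B * (B - 1)))) := by
  refine ⟨fun β _ h => ?_, ?_, fun β _ => hω.monotone_quenchedFreeEnergy hB1 β, fun n => ?_,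
    fun n β _ => hω.monotone_finiteFreeEnergy hB1 β n, fun β _ h n hn =>
      ⟨hω.finiteFreeEnergy_sub_le hB1 β h n, hω.quenchedFreeEnergy_le hB1 β h hn⟩⟩
  · obtain ⟨hae, hL1⟩ := hω.tendsto_randomFreeEnergy hκ0.le hκ1.le hB1 β h
    exact ⟨hae, fun n => (hω.memLp_randomFreeEnergy hB1 β h n).integrable one_le_two, hL1,
      hω.tendsto_finiteFreeEnergy hB1 β h, hω.quenchedFreeEnergy_nonneg hB1 β h⟩
  · exact (hω.convexOn_quenchedFreeEnergy hB1).subset (Set.subset_univ _)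
      (convex_halfSpace_ge (LinearMap.fst ℝ ℝ ℝ).isLinear 0)
  · exact (hω.convexOn_finiteFreeEnergy hB1 n).subset (Set.subset_univ _)
      (convex_halfSpace_ge (LinearMap.fst ℝ ℝ ℝ).isLinear 0)
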